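/- Let $L'=\{x0^{|x|}\$0^{|x|}x^T \mid x\in\{0,1\}^*\}$, a language over the alphabet $\{0,1,\$\}$, where $x^T$ is the reversal of $x$. A $k$-counter machine has a finite set of states with a start state and a set of final states, one two-way read-only head on the input, which is bordered by two end-markers, and $k$ counters holding nonnegative integers. In one step, depending on its state, the symbol under the head and which counters are zero, it changes its state, moves the head by at most one square and changes every counter by at most one; it may be deterministic or nondeterministic. It starts on the square next to the left end-marker with all counters zero, and it accepts when it enters a final state, with the head at any position. It recognizes the language of the inputs on which it has an accepting computation. (1) Let $M$ be a $1$-counter machine with $s$ states that recognizes $L'$. There is a constant $d$, depending on $M$, such that for all sufficiently large $n$ with $n\equiv 1 \pmod 4$ there is an input $w\in L'$ of length $n$ on which every accepting computation of $M$ has at least $$\frac{n^2-16n\log_2 n-dn}{8(\log_2 n+2\log_2 s+1)}$$ steps. (2) Let $k\ge 1$ and let $M$ be a $k$-counter machine with $s$ states that recognizes $L'$. There is a constant $d$, depending on $M$, such that for all sufficiently large $n$ with $n\equiv 1 \pmod 4$ there is an input $w\in L'$ of length $n$ on which every accepting computation of $M$ has at least $$\frac{n^2-16n\log_2 n-dn}{8(2k\log_2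 n+\log_2 s)}$$ steps. -/

import Mathlib

/-- The input alphabet `{0, 1, $}`: the bits are `bit false` (the letter 0) and `bit true`
(the letter 1), and `marker` is the letter `$`. -/
inductive Letter : Type where
  | bit (b : Bool)
  | marker

/-- What the head of a two-way machine can see: an input letter or one of the two end-markers. -/
inductive TapeSymbol (α : Type*) where
  | leftEnd
  | letter (a : α)
  | rightEnd

/-- The content of square `p` of the tape with input `w`: the left end-marker is on square `0`,
the letters of `w` are on the squares `1, …, |w|`, and the right end-marker is on square
`|w| + 1`. -/
def tapeAt {α : Type*} (w : List α) : ℕ → TapeSymbol α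
  | 0 => .leftEnd
  | p + 1 => match w[p]? with
    | some a => .letter a
    | none => .rightEnd

/-- A (possibly nondeterministic) two-way machine with input alphabet `α`, states `Q` and `k`
counters. Given the current state, the symbol under the head and the outcome of the zero-test of
every counter (`true` if the counter is zero), `trans` is the set of the possible actions: a new
state, a head movement (left, none, right) and a change of every counter (`-1`, `0`, `+1`).
A deterministic machine is one for which all these sets have at most one element. -/
structure CounterMachine (α Q : Type*) (k : ℕ) where
  start : Q
  final : Set Q
  trans : Q → TapeSymbol α → (Fin k → Bool) → Set (Q × SignType × (Fin k → SignType))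

/-- A configuration: state, head position and the contents of the counters. -/
structure CounterConfig (Q : Type*) (k : ℕ) where
  state : Q
  head : ℕ
  counter : Fin k → ℕ

namespace CounterMachine

variable {α Q : Type*} {k : ℕ}

/-- The initial configuration: the head is next to the left end-marker, all counters are zero. -/
def init (M : CounterMachine α Q k) : CounterConfig Q k :=
  ⟨M.start, 1, fun _ => 0⟩

/-- `M.Step w C C'`: on input `w`, the machine can go from `C` to `C'` in one step. An action
that would move the head beyond an end-marker, or decrement a counter that is zero, cannot be
carried out. -/
def Step (M : CounterMachine α Q k) (w : List α) (C C' : CounterConfig Q k) : Prop :=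
  ∃ (move : SignType) (change : Fin k → SignType),
    (C'.state, move, change) ∈
      M.trans C.state (tapeAt w C.head) (fun i => decide (C.counter i = 0)) ∧
    (C'.head : ℤ) = (C.head : ℤ) + (move : ℤ) ∧
    C'.head ≤ w.length + 1 ∧
    ∀ i, (C'.counter i : ℤ) = (C.counter i : ℤ) + (change i : ℤ)

/-- `M.AcceptsIn w t`: some computation of `M` on `w` is in a final state after `t` steps. -/
def AcceptsIn (M : CounterMachine α Q k) (w : List α) (t : ℕ) : Prop :=
  ∃ run : ℕ → CounterConfig Q k,
    run 0 = M.init ∧ (∀ j < t, M.Step w (run j) (run (j + 1))) ∧ (run t).state ∈ M.final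

/-- `M` recognizes the language of the inputs on which some computation of `M` reaches a final
state (with the head at any position and any counter contents). -/
def Recognizes (M : CounterMachine α Q k) (L : Language α) : Prop :=
  ∀ w : List α, w ∈ L ↔ ∃ t, M.AcceptsIn w t

/-- `M.RequiresSteps w b`: the input `w` is accepted, but by no computation of `M` with fewer than
`b` steps. -/
def RequiresSteps (M : CounterMachine α Q k) (w : List α) (b : ℝ) : Prop :=
  (∃ t, M.AcceptsIn w t) ∧ ∀ t : ℕ, M.AcceptsIn w t → b ≤ (t : ℝ)

end CounterMachine

/-- The marked palindromes with desert: `{ x 0^|x| $ 0^|x| xᵀ | x ∈ {0, 1}* }`, where `xᵀ` is the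
reversal of `x`. -/
def desertPalindromes : Language Letter :=
  {w | ∃ x : List Bool, w =
    x.map Letter.bit ++ List.replicate x.length (Letter.bit false) ++ [Letter.marker] ++
      List.replicate x.length (Letter.bit false) ++ x.reverse.map Letter.bit}

/-! At a boundary between two squares, record for every crossing the state and the change of each
counter since the previous crossing. Two accepting runs with equal records at a desert boundary can
be pasted together (`AcceptingPath.splice`); for inputs built from x ≠ y of length m this would
accept x0^m$0^m yᵀ. So the records of the 2^m inputs at a fixed desert boundary are distinct. If all
inputs are accepted within T steps, each has, among 2m boundaries, one with at most T/(2m)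
crossings, and by pigeonhole many inputs share this boundary and the number of crossings.

Recording changes instead of contents keeps the records few: the changes of one counter have
absolute sum at most T. A weighted count (`mul_logb_card_le`) then charges about log s + k(log n +
2) bits for each of T/(2m) crossings. These bits must cover m - O(log n), which with n = 4m + 1
gives the n²/8 of the theorem. -/

namespace CounterMachine

/-! ### Accepting computations as lists -/

open Relation

variable {α Q : Type*} {k : ℕ}

/-- Some configuration with a final state can be reached from `C` on input `w`. -/
def AcceptsFrom (M : CounterMachine α Q k) (w : List α) (C : CounterConfig Q k) : Prop :=
  ∃ C', ReflTransGen (M.Step w) C C' ∧ C'.state ∈ M.final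

/-- The list `l` continues the configuration `C` to an accepting computation on input `w`. -/
def AcceptingPath (M : CounterMachine α Q k) (w : List α) :
    CounterConfig Q k → List (CounterConfig Q k) → Prop
  | C, [] => C.state ∈ M.final
  | C, C' :: l => M.Step w C C' ∧ M.AcceptingPath w C' l

theorem exists_acceptingPath (M : CounterMachine α Q k) (w : List α) (t : ℕ) :
    ∀ run : ℕ → CounterConfig Q k, (∀ j < t, M.Step w (run j) (run (j + 1))) →
      (run t).state ∈ M.final → ∃ l, l.length = t ∧ M.AcceptingPath w (run 0) l := by
  induction t with
  | zero => exact fun run _ hf => ⟨[], rfl, hf⟩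
  | succ t ih =>
    intro run hs hf
    obtain ⟨l, hl, hp⟩ := ih (fun j => run (j + 1)) (fun j hj => hs (j + 1) (by omega)) hf
    exact ⟨run 1 :: l, by simp [hl], hs 0 (by omega), hp⟩

theorem AcceptsFrom.exists_acceptsIn {M : CounterMachine α Q k} {w : List α}
    (h : M.AcceptsFrom w M.init) : ∃ t, M.AcceptsIn w t := by
  obtain ⟨C', hC, hf⟩ := h
  suffices ∃ (t : ℕ) (run : ℕ → CounterConfig Q k),
      run 0 = M.init ∧ (∀ j < t, M.Step w (run j) (run (j + 1))) ∧ run t = C' by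
    obtain ⟨t, run, h0, hs, ht⟩ := this
    exact ⟨t, run, h0, hs, ht ▸ hf⟩
  clear hf
  induction hC with
  | refl => exact ⟨0, fun _ => M.init, rfl, by simp, rfl⟩
  | @tail D E _ hDE ih =>
    obtain ⟨t, run, h0, hs, ht⟩ := ih
    refine ⟨t + 1, fun j => if j ≤ t then run j else E, by simp [h0], fun j hj => ?_, by simp⟩
    rcases Nat.lt_succ_iff_lt_or_eq.mp hj with hj | rfl
    · simpa [hj.le, Nat.succ_le_of_lt hj] using hs j hj
    · simpa [ht] using hDE

/-! ### Crossing sequences and their size -/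

/-- A step from `C` to `C'` crosses the boundary between the squares `p` and `p + 1`. -/
def Crosses (p : ℕ) (C C' : CounterConfig Q k) : Prop := ¬(C.head ≤ p ↔ C'.head ≤ p)

open Classical in
/-- The crossing sequence at the boundary between the squares `p` and `p + 1` of the computation
`C :: l`: for every crossing, the state and the changes of the counters since the previous
crossing. The counter contents `prev` are those of the previous crossing. -/
noncomputable def crossings (p : ℕ) :
    (Fin k → ℕ) → CounterConfig Q k → List (CounterConfig Q k) → List (Q × (Fin k → ℤ))
  | _, _, [] => []
  | prev, C, C' :: l =>
    if Crosses p C C' then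
      (C'.state, fun i => (C'.counter i : ℤ) - prev i) :: crossings p C'.counter C' l
    else crossings p prev C' l

theorem Step.abs_head_sub_le {M : CounterMachine α Q k} {w : List α} {C C' : CounterConfig Q k}
    (h : M.Step w C C') : |(C'.head : ℤ) - C.head| ≤ 1 := by
  obtain ⟨move, _, _, hm, _⟩ := h
  rw [hm, add_sub_cancel_left]
  cases move <;> simp

theorem Step.abs_counter_sub_le {M : CounterMachine α Q k} {w : List α}
    {C C' : CounterConfig Q k} (h : M.Step w C C') (i : Fin k) :
    |(C'.counter i : ℤ) - C.counter i| ≤ 1 := by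
  obtain ⟨_, change, _, _, _, hc⟩ := h
  rw [hc, add_sub_cancel_left]
  cases change i <;> simp

theorem Step.congr_word {M : CounterMachine α Q k} {w w' : List α} {C C' : CounterConfig Q k}
    (h : M.Step w C C') (hl : w'.length = w.length)
    (ht : tapeAt w' C.head = tapeAt w C.head) : M.Step w' C C' := by
  simpa only [Step, hl, ht] using h

theorem Step.head_of_crosses {M : CounterMachine α Q k} {w : List α} {p : ℕ}
    {C C' : CounterConfig Q k} (h : M.Step w C C') (hc : Crosses p C C') :
    C'.head = if C.head ≤ p then p + 1 else p := by
  have := abs_le.mp h.abs_head_sub_le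
  unfold Crosses at hc
  split_ifs <;> omega

/-- The total length of the crossing sequences at different boundaries is at most the number of
steps. -/
theorem sum_length_crossings_le (M : CounterMachine α Q k) (w : List α) (s : Finset ℕ)
    (prev : ℕ → Fin k → ℕ) (C : CounterConfig Q k) (l : List (CounterConfig Q k))
    (h : M.AcceptingPath w C l) : ∑ p ∈ s, (crossings p (prev p) C l).length ≤ l.length := by
  classical
  induction l generalizing C prev with
  | nil => simp [crossings]
  | cons C' l ih =>
    have key : ∀ p, (crossings p (prev p) C (C' :: l)).length =
        (if Crosses p C C' then 1 else 0) +
          (crossings p (if Crosses p C C' then C'.counter else prev p) C' l).length := by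
      intro p
      rw [crossings]
      split_ifs <;> simp [add_comm]
    rw [Finset.sum_congr rfl fun p _ => key p, Finset.sum_add_distrib, List.length_cons,
      add_comm]
    refine add_le_add (ih _ C' h.2) ?_
    -- The head moves by at most one square, so a step crosses at most one boundary.
    rw [← Finset.card_filter, Finset.card_le_one]
    have := abs_le.mp h.1.abs_head_sub_le
    intro a ha b hb
    have ha := (Finset.mem_filter.mp ha).2
    have hb := (Finset.mem_filter.mp hb).2
    rw [Crosses] at ha hb
    omega

/-- The total change of a counter between the crossings is at most the number of steps. -/
theorem sum_abs_crossings_le (M : CounterMachine α Q k) (w : List α) (p : ℕ) (i : Fin k)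
    (prev : Fin k → ℕ) (C : CounterConfig Q k) (l : List (CounterConfig Q k))
    (h : M.AcceptingPath w C l) :
    ((crossings p prev C l).map fun a => (a.2 i).natAbs).sum ≤
      ((C.counter i : ℤ) - prev i).natAbs + l.length := by
  induction l generalizing C prev with
  | nil => simp [crossings]
  | cons C' l ih =>
    have := abs_le.mp (h.1.abs_counter_sub_le i)
    rw [crossings]
    split_ifs
    · have := ih C'.counter C' h.2
      simp only [List.map_cons, List.sum_cons, List.length_cons]
      omega
    · have := ih prev C' h.2
      simp only [List.length_cons]
      omega

/-! ### Cut and paste at a boundary -/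

theorem AcceptingPath.acceptsFrom_of_crossings_eq_nil {M : CounterMachine α Q k}
    {w w' : List α} {p : ℕ} {prev : Fin k → ℕ} {C : CounterConfig Q k}
    {l : List (CounterConfig Q k)} (h : M.AcceptingPath w C l) (hl : w'.length = w.length)
    (ht : ∀ q, (q ≤ p ↔ C.head ≤ p) → tapeAt w' q = tapeAt w q)
    (hc : crossings p prev C l = []) : M.AcceptsFrom w' C := by
  induction l generalizing C with
  | nil => exact ⟨C, .refl, h⟩
  | cons C' l ih =>
    rw [crossings] at hc
    split_ifs at hc with hcr
    rw [Crosses, not_not] at hcr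
    obtain ⟨D, hD, hf⟩ := ih h.2 (fun q hq => ht q (hq.trans hcr.symm)) hc
    exact ⟨D, .head (h.1.congr_word hl (ht _ Iff.rfl)) hD, hf⟩

/-- The configuration after the first crossing depends only on the recorded entry, `prev` and the
side of the head, so runs with equal records resume from the same configuration. `toNat` loses
nothing, as the sum is an actual counter content. -/
theorem AcceptingPath.exists_of_crossings_eq_cons {M : CounterMachine α Q k}
    {w : List α} {p : ℕ} {prev : Fin k → ℕ} {C : CounterConfig Q k}
    {l : List (CounterConfig Q k)} (h : M.AcceptingPath w C l)
    {a : Q × (Fin k → ℤ)} {as : List (Q × (Fin k → ℤ))} (hc : crossings p prev C l = a :: as) :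
    ∃ l', M.AcceptingPath w
        ⟨a.1, if C.head ≤ p then p + 1 else p, fun i => (a.2 i + prev i).toNat⟩ l' ∧
      crossings p (fun i => (a.2 i + prev i).toNat)
        ⟨a.1, if C.head ≤ p then p + 1 else p, fun i => (a.2 i + prev i).toNat⟩ l' = as := by
  induction l generalizing C with
  | nil => simp [crossings] at hc
  | cons C' l ih =>
    rw [crossings] at hc
    split_ifs at hc with hcr
    · obtain ⟨rfl, rfl⟩ := List.cons.inj hc
      have hh := h.1.head_of_crosses hcr
      refine ⟨l, ?_⟩
      obtain ⟨q, hd, c⟩ := C'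
      simp only at hh
      simp only [sub_add_cancel, Int.toNat_natCast, ← hh]
      exact ⟨h.2, trivial⟩
    · rw [Crosses, not_not] at hcr
      simpa only [hcr] using ih h.2 hc

/-- Up to and including the crossing step, only squares on the starting side are read. -/
theorem AcceptingPath.reflTransGen_of_crossings_eq_cons {M : CounterMachine α Q k}
    {w w' : List α} {p : ℕ} {prev : Fin k → ℕ} {C : CounterConfig Q k}
    {l : List (CounterConfig Q k)} (h : M.AcceptingPath w C l) (hl : w'.length = w.length)
    (ht : ∀ q, (q ≤ p ↔ C.head ≤ p) → tapeAt w' q = tapeAt w q)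
    {a : Q × (Fin k → ℤ)} {as : List (Q × (Fin k → ℤ))} (hc : crossings p prev C l = a :: as) :
    ReflTransGen (M.Step w') C
      ⟨a.1, if C.head ≤ p then p + 1 else p, fun i => (a.2 i + prev i).toNat⟩ := by
  induction l generalizing C with
  | nil => simp [crossings] at hc
  | cons C' l ih =>
    have hs := h.1.congr_word hl (ht _ Iff.rfl)
    rw [crossings] at hc
    split_ifs at hc with hcr
    · obtain ⟨rfl, rfl⟩ := List.cons.inj hc
      have hh := h.1.head_of_crosses hcr
      obtain ⟨q, hd, c⟩ := C'
      simp only at hh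
      simp only [sub_add_cancel, Int.toNat_natCast, ← hh]
      exact .single hs
    · rw [Crosses, not_not] at hcr
      simp only [hcr] at ih ⊢
      exact .head hs (ih h.2 (fun q hq => ht q (by rwa [hcr])) hc)

/-- Cut and paste: two accepting computations with the same crossing sequence at a boundary
combine to an accepting computation on the input composed of the left part of the first and the
right part of the second input. -/
theorem AcceptingPath.splice {M : CounterMachine α Q k} {w₁ w₂ w : List α} {p : ℕ}
    (hl₁ : w.length = w₁.length) (hl₂ : w.length = w₂.length)
    (ht₁ : ∀ q ≤ p, tapeAt w q = tapeAt w₁ q) (ht₂ : ∀ q, p < q → tapeAt w q = tapeAt w₂ q)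
    (as : List (Q × (Fin k → ℤ))) {prev : Fin k → ℕ} {C₁ C₂ : CounterConfig Q k}
    {l₁ l₂ : List (CounterConfig Q k)} (hC : C₁.head ≤ p ↔ C₂.head ≤ p)
    (h₁ : M.AcceptingPath w₁ C₁ l₁) (h₂ : M.AcceptingPath w₂ C₂ l₂)
    (hc₁ : crossings p prev C₁ l₁ = as) (hc₂ : crossings p prev C₂ l₂ = as) :
    M.AcceptsFrom w (if C₁.head ≤ p then C₁ else C₂) := by
  induction as generalizing prev C₁ C₂ l₁ l₂ with
  | nil =>
    split_ifs with hp
    · exact h₁.acceptsFrom_of_crossings_eq_nil hl₁ (fun q hq => ht₁ q (hq.2 hp)) hc₁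
    · exact h₂.acceptsFrom_of_crossings_eq_nil hl₂ (fun q hq => ht₂ q (by omega)) hc₂
  | cons a as ih =>
    obtain ⟨l₁', h₁', hc₁'⟩ := h₁.exists_of_crossings_eq_cons hc₁
    obtain ⟨l₂', h₂', hc₂'⟩ := h₂.exists_of_crossings_eq_cons hc₂
    simp only [← hC] at h₂' hc₂'
    obtain ⟨D, hD, hf⟩ := ih Iff.rfl h₁' h₂' hc₁' hc₂'
    -- Both runs resume from one configuration, so the choice of side disappears.
    rw [ite_self] at hD
    refine ⟨D, .trans ?_ hD, hf⟩
    split_ifs with hp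
    · simpa only [hp, if_true] using
        h₁.reflTransGen_of_crossings_eq_cons hl₁ (fun q hq => ht₁ q (hq.2 hp)) hc₁
    · simpa only [← hC, hp, if_false] using
        h₂.reflTransGen_of_crossings_eq_cons hl₂ (fun q hq => ht₂ q (by omega)) hc₂

end CounterMachine

/-! ### Counting words by weight -/

section Counting

/-- The sum is part of the expansion of the `ℓ`-th power of a finite sum of weights. Bounding all
finite sums by `V` allows an infinite alphabet. -/
theorem sum_prod_map_le_pow {A : Type*} (W : A → ℝ) (hW : ∀ a, 0 ≤ W a) (V : ℝ)
    (hV : ∀ s : Finset A, ∑ a ∈ s, W a ≤ V) (ℓ : ℕ) (G : Finset (List A))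
    (hl : ∀ l ∈ G, l.length = ℓ) : ∑ l ∈ G, (l.map W).prod ≤ V ^ ℓ := by
  classical
  have hp : ∀ l : List A, 0 ≤ (l.map W).prod := fun l =>
    List.prod_nonneg (by simpa using fun a _ => hW a)
  induction ℓ generalizing G with
  | zero =>
    have : G ⊆ {[]} := fun l h => by simpa using hl l h
    exact (Finset.sum_le_sum_of_subset_of_nonneg this fun l _ _ => hp l).trans (by simp)
  | succ ℓ ih =>
    set s := G.biUnion List.toFinset
    set G' := G.image List.tail
    have hsub : G ⊆ (s ×ˢ G').image fun x => x.1 :: x.2 := by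
      intro l h
      obtain ⟨a, l', rfl⟩ := List.exists_cons_of_length_eq_add_one (hl l h)
      refine Finset.mem_image.mpr ⟨(a, l'), Finset.mem_product.mpr ⟨?_, ?_⟩, rfl⟩
      · exact Finset.mem_biUnion.mpr ⟨_, h, by simp⟩
      · exact Finset.mem_image.mpr ⟨_, h, rfl⟩
    have hG' : ∀ l ∈ G', l.length = ℓ := by
      intro l h
      obtain ⟨l', h', rfl⟩ := Finset.mem_image.mp h
      simp [hl l' h']
    have hV0 : 0 ≤ V := by simpa using hV ∅
    calc ∑ l ∈ G, (l.map W).prod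
        ≤ ∑ l ∈ (s ×ˢ G').image fun x => x.1 :: x.2, (l.map W).prod :=
          Finset.sum_le_sum_of_subset_of_nonneg hsub fun l _ _ => hp l
      _ = (∑ a ∈ s, W a) * ∑ l ∈ G', (l.map W).prod := by
          rw [Finset.sum_image fun x _ y _ h => Prod.ext (List.cons.inj h).1 (List.cons.inj h).2,
            Finset.sum_mul_sum, Finset.sum_product]
          simp
      _ ≤ V * V ^ ℓ := mul_le_mul (hV s) (ih G' hG') (Finset.sum_nonneg fun l _ => hp l) hV0
      _ = V ^ (ℓ + 1) := by ring

/-- If the weights of the letters sum to at most `V`, then at most `V ^ ℓ / c` words of length `ℓ`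
have weight at least `c`. -/
theorem card_mul_le_pow_of_weight {ι A : Type*} (W : A → ℝ) (hW : ∀ a, 0 ≤ W a) (V : ℝ)
    (hV : ∀ s : Finset A, ∑ a ∈ s, W a ≤ V) (ℓ : ℕ) (c : ℝ) (F : Finset ι) (f : ι → List A)
    (hf : Set.InjOn f F) (hl : ∀ x ∈ F, (f x).length = ℓ)
    (hc : ∀ x ∈ F, c ≤ ((f x).map W).prod) : (F.card : ℝ) * c ≤ V ^ ℓ := by
  classical
  calc (F.card : ℝ) * c = ∑ _x ∈ F, c := by simp
    _ ≤ ∑ x ∈ F, ((f x).map W).prod := Finset.sum_le_sum hc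
    _ = ∑ l ∈ F.image f, (l.map W).prod := (Finset.sum_image (f := fun l => (l.map W).prod) hf).symm
    _ ≤ V ^ ℓ := sum_prod_map_le_pow W hW V hV ℓ _ (by simpa using hl)

/-- Two geometric series, one for each sign. -/
theorem sum_pow_natAbs_le (r : ℝ) (h0 : 0 ≤ r) (h1 : r < 1) (s : Finset ℤ) :
    ∑ z ∈ s, r ^ z.natAbs ≤ 2 / (1 - r) := by
  have key : ∀ s' : Finset ℤ, Set.InjOn Int.natAbs s' →
      ∑ z ∈ s', r ^ z.natAbs ≤ (1 - r)⁻¹ := by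
    intro s' hs'
    rw [← Finset.sum_image (f := fun j => r ^ j) hs', ← tsum_geometric_of_lt_one h0 h1]
    exact (summable_geometric_of_lt_one h0 h1).sum_le_tsum _ fun _ _ => by positivity
  have hp := key (s.filter (0 ≤ ·)) (by intro a ha b hb h; simp at ha hb h; omega)
  have hn := key (s.filter (¬0 ≤ ·)) (by intro a ha b hb h; simp at ha hb h; omega)
  rw [← Finset.sum_filter_add_sum_filter_not s (0 ≤ ·), div_eq_mul_inv, two_mul]
  exact add_le_add hp hn

theorem sum_prod_pow_natAbs_le {Q : Type*} [Fintype Q] {k : ℕ} (r : ℝ) (h0 : 0 ≤ r) (h1 : r < 1)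
    (s : Finset (Q × (Fin k → ℤ))) :
    ∑ a ∈ s, ∏ i, r ^ (a.2 i).natAbs ≤ Fintype.card Q * (2 / (1 - r)) ^ k := by
  classical
  set t : Fin k → Finset ℤ := fun i => s.image fun a => a.2 i
  have hsub : s ⊆ Finset.univ ×ˢ Fintype.piFinset t := by
    intro a ha
    simp only [Finset.mem_product, Finset.mem_univ, true_and, Fintype.mem_piFinset]
    exact fun i => Finset.mem_image.mpr ⟨a, ha, rfl⟩
  calc ∑ a ∈ s, ∏ i, r ^ (a.2 i).natAbs
      ≤ ∑ a ∈ Finset.univ ×ˢ Fintype.piFinset t, ∏ i, r ^ (a.2 i).natAbs :=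
        Finset.sum_le_sum_of_subset_of_nonneg hsub fun a _ _ => by positivity
    _ = Fintype.card Q * ∏ i, ∑ z ∈ t i, r ^ z.natAbs := by
        rw [Finset.sum_product, Finset.prod_univ_sum]
        simp
    _ ≤ Fintype.card Q * ∏ _i : Fin k, (2 / (1 - r)) := by
        gcongr with i
        exact sum_pow_natAbs_le r h0 h1 _
    _ = Fintype.card Q * (2 / (1 - r)) ^ k := by rw [Fin.prod_const]

theorem prod_map_prod_pow_natAbs {Q : Type*} {k : ℕ} (r : ℝ) (l : List (Q × (Fin k → ℤ))) :
    (l.map fun a => ∏ i, r ^ (a.2 i).natAbs).prod =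
      ∏ i, r ^ (l.map fun a => (a.2 i).natAbs).sum := by
  induction l with
  | nil => simp
  | cons a l ih => simp [ih, pow_add, Finset.prod_mul_distrib]

/-- A bound on the number of words of length at most `T / N` over `Q × ℤᵏ` in which the sum of the
absolute values of every integer component is at most `T`. -/
theorem mul_logb_card_le {ι Q : Type*} [Fintype Q] [Nonempty Q] {k N ℓ T : ℕ} (hN : 0 < N)
    (hev : Even N) (hT : N * ℓ ≤ T) (F : Finset ι) (hF : F.Nonempty) (f : ι → List (Q × (Fin k → ℤ)))
    (hf : Set.InjOn f F) (hl : ∀ x ∈ F, (f x).length = ℓ)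
    (hs : ∀ x ∈ F, ∀ i, ((f x).map fun a => (a.2 i).natAbs).sum ≤ T) :
    N * Real.logb 2 F.card ≤
      T * (Real.logb 2 (Fintype.card Q) + k * (Real.logb 2 (2 * N) + 2)) := by
  have hN' : (2 : ℝ) ≤ N := by
    obtain ⟨j, rfl⟩ := hev
    exact_mod_cast (by omega : 2 ≤ j + j)
  -- This ratio balances two costs: each counter contributes a factor `2 * N` to the total letter
  -- weight, while a total change `T` costs a word at most the factor `4 ^ (T / N)`.
  set r : ℝ := 1 - 1 / N with hr
  have hinv : 1 / (N : ℝ) ≤ 1 / 2 := by gcongr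
  have hpos : 0 < 1 / (N : ℝ) := by positivity
  have hr0 : 0 < r := by linarith
  have hr1 : r < 1 := by linarith
  have hcard : (0 : ℝ) < Fintype.card Q := by exact_mod_cast Fintype.card_pos
  have hFc : (0 : ℝ) < F.card := by exact_mod_cast hF.card_pos
  have hV : 2 / (1 - r) = 2 * N := by rw [hr]; field_simp; ring
  -- Bernoulli's inequality is vacuous at exponent `N` but gives `1 / 2` at `N / 2`; hence the
  -- evenness.
  have hrN : (1 / 4 : ℝ) ≤ r ^ N := by
    obtain ⟨j, rfl⟩ := hev
    have hj : (0 : ℝ) < j := by exact_mod_cast (by omega : 0 < j)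
    have hb : 1 + (j : ℝ) * (r - 1) ≤ r ^ j := by
      simpa using one_add_mul_le_pow (a := r - 1) (by linarith) j
    have h1 : (1 / 2 : ℝ) ≤ r ^ j := by
      refine le_trans (le_of_eq ?_) hb
      rw [hr]
      push_cast
      field_simp
      ring
    rw [pow_add]
    nlinarith
  have main : (F.card : ℝ) * (r ^ T) ^ k ≤ (Fintype.card Q * (2 * N : ℝ) ^ k) ^ ℓ := by
    rw [← hV]
    refine card_mul_le_pow_of_weight (fun a => ∏ i, r ^ (a.2 i).natAbs)
      (fun a => by positivity) _ (sum_prod_pow_natAbs_le r hr0.le hr1) ℓ _ F f hf hl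
      fun x hx => ?_
    rw [prod_map_prod_pow_natAbs, ← Fin.prod_const]
    exact Finset.prod_le_prod (fun _ _ => by positivity) fun i _ =>
      pow_le_pow_of_le_one hr0.le hr1.le (hs x hx i)
  have hlog := Real.logb_le_logb_of_le one_lt_two (by positivity) main
  rw [Real.logb_mul (by positivity) (by positivity), Real.logb_pow, Real.logb_pow, Real.logb_pow,
    Real.logb_mul (by positivity) (by positivity), Real.logb_pow] at hlog
  have hlr : -2 ≤ N * Real.logb 2 r := by
    have h := Real.logb_le_logb_of_le one_lt_two (by norm_num) hrN
    rw [Real.logb_pow, show (1 / 4 : ℝ) = 2 ^ (-2 : ℝ) by norm_num [Real.rpow_neg],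
      Real.logb_rpow (by norm_num) (by norm_num)] at h
    exact h
  have hT' : (N : ℝ) * ℓ ≤ T := by exact_mod_cast hT
  have hA : 0 ≤ Real.logb 2 (Fintype.card Q) + k * Real.logb 2 (2 * N) :=
    add_nonneg (Real.logb_nonneg one_lt_two (by exact_mod_cast Fintype.card_pos))
      (mul_nonneg (by positivity) (Real.logb_nonneg one_lt_two (by linarith)))
  have e1 := mul_le_mul_of_nonneg_left hlog (by positivity : (0 : ℝ) ≤ N)
  have e2 := mul_le_mul_of_nonneg_right hT' hA
  have e3 := mul_le_mul_of_nonneg_left hlr (by positivity : (0 : ℝ) ≤ k * T)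
  linarith

end Counting

/-! ### The language and the time bound -/

section DesertPalindromes

open CounterMachine

/-- The word `x 0^m $ 0^m yᵀ`, where `m` is the length of `x`. -/
def desertWord (x y : List Bool) : List Letter :=
  x.map Letter.bit ++ List.replicate x.length (Letter.bit false) ++ [Letter.marker] ++
    List.replicate x.length (Letter.bit false) ++ y.reverse.map Letter.bit

theorem length_desertWord (x y : List Bool) :
    (desertWord x y).length = 3 * x.length + 1 + y.length := by
  simp [desertWord]; ring

theorem desertWord_self_mem (x : List Bool) : desertWord x x ∈ desertPalindromes := ⟨x, rfl⟩

theorem eq_of_desertWord_mem {x y : List Bool} (hl : x.length = y.length)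
    (h : desertWord x y ∈ desertPalindromes) : x = y := by
  obtain ⟨z, hz⟩ := h
  change _ = desertWord z z at hz
  have hlen := congrArg List.length hz
  rw [length_desertWord, length_desertWord] at hlen
  have hxz : x.length = z.length := by omega
  have hinj : Function.Injective Letter.bit := fun _ _ => Letter.bit.inj
  obtain ⟨h1, h2⟩ := List.append_inj hz (by simp [hxz])
  have hx := (List.append_inj (by simpa only [List.append_assoc] using h1) (by simp [hxz])).1
  rw [hinj.list_map hx, List.reverse_injective (hinj.list_map h2)]

theorem tapeAt_desertWord_left {x y y' : List Bool} {q : ℕ} (hq : q ≤ 3 * x.length + 1) :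
    tapeAt (desertWord x y) q = tapeAt (desertWord x y') q := by
  cases q with
  | zero => rfl
  | succ q =>
    have key : ∀ z, (desertWord x z)[q]? = (x.map Letter.bit ++
        List.replicate x.length (Letter.bit false) ++ [Letter.marker] ++
          List.replicate x.length (Letter.bit false))[q]? := fun z =>
      List.getElem?_append_left (by simp; omega)
    simp only [tapeAt, key]

theorem tapeAt_desertWord_right {x x' y : List Bool} {q : ℕ} (hl : x.length = x'.length)
    (hq : x.length < q) :
    tapeAt (desertWord x y) q = tapeAt (desertWord x' y) q := by
  cases q with
  | zero => rfl
  | succ q =>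
    have key : ∀ z : List Bool, z.length = x.length → (desertWord z y)[q]? =
        (List.replicate x.length (Letter.bit false) ++ ([Letter.marker] ++
          (List.replicate x.length (Letter.bit false) ++ y.reverse.map Letter.bit)))[q - x.length]? := by
      intro z hz
      rw [desertWord, List.append_assoc, List.append_assoc, List.append_assoc,
        List.getElem?_append_right (by simp; omega), List.length_map, hz]
    simp only [tapeAt, key x rfl, key x' hl.symm]

/-- A single state would have to be final, and the empty word would be accepted at once. -/
theorem CounterMachine.Recognizes.two_le_card {Q : Type*} [Fintype Q] {k : ℕ}
    {M : CounterMachine Letter Q k} (hM : M.Recognizes desertPalindromes) :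
    2 ≤ Fintype.card Q := by
  by_contra hlt
  have : Subsingleton Q := Fintype.card_le_one_iff_subsingleton.mp (by omega)
  obtain ⟨t, run, _, _, hf⟩ := (hM _).1 (desertWord_self_mem [])
  rw [Subsingleton.elim (run t).state M.start] at hf
  obtain ⟨z, hz⟩ := (hM []).2 ⟨0, fun _ => M.init, rfl, by simp, hf⟩
  simp at hz

/-- Pairs of different inputs have different crossing sequences in the desert. -/
theorem CounterMachine.Recognizes.eq_of_crossings_eq {Q : Type*} {k : ℕ}
    {M : CounterMachine Letter Q k} (hM : M.Recognizes desertPalindromes) {x y : List Bool}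
    (hl : x.length = y.length) {p : ℕ} (hp : x.length ≤ p) (hp' : p ≤ 3 * x.length)
    {lx ly : List (CounterConfig Q k)} (hx : M.AcceptingPath (desertWord x x) M.init lx)
    (hy : M.AcceptingPath (desertWord y y) M.init ly)
    (hc : crossings p (fun _ => 0) M.init lx = crossings p (fun _ => 0) M.init ly) : x = y := by
  have h := hx.splice (w := desertWord x y) (p := p) (by simp [length_desertWord, hl])
    (by simp [length_desertWord, hl]) (fun q hq => tapeAt_desertWord_left (by omega))
    (fun q hq => tapeAt_desertWord_right hl (by omega)) _ Iff.rfl hy hc rfl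
  rw [ite_self] at h
  exact eq_of_desertWord_mem hl ((hM _).2 h.exists_acceptsIn)

/-- If all words `x 0^m $ 0^m xᵀ` with `|x| = m` are accepted within `T` steps, then the crossing
sequences at the `2m` boundaries in the desert have to be long. -/
theorem CounterMachine.Recognizes.sq_le_mul {Q : Type*} [Fintype Q] {k : ℕ}
    {M : CounterMachine Letter Q k} (hM : M.Recognizes desertPalindromes) {m T : ℕ} (hm : 1 ≤ m)
    (h : ∀ x : List Bool, x.length = m → ∃ t ≤ T, M.AcceptsIn (desertWord x x) t)
    {L : ℕ} (hL : T < 2 * m * L) :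
    (2 * m * m : ℝ) ≤ 2 * m * (Real.logb 2 (2 * m) + Real.logb 2 L) +
      T * (Real.logb 2 (Fintype.card Q) + k * (Real.logb 2 (4 * m) + 2)) := by
  classical
  have : Nonempty Q := ⟨M.start⟩
  have hpath : ∀ v : Fin m → Bool, ∃ l : List (CounterConfig Q k), l.length ≤ T ∧
      M.AcceptingPath (desertWord (List.ofFn v) (List.ofFn v)) M.init l := by
    intro v
    obtain ⟨t, ht, run, h0, hs, hf⟩ := h (List.ofFn v) (by simp)
    obtain ⟨l, hl, hp⟩ := M.exists_acceptingPath _ t run hs hf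
    exact ⟨l, hl.trans_le ht, h0 ▸ hp⟩
  choose path hlen hacc using hpath
  set code : ℕ → (Fin m → Bool) → List (Q × (Fin k → ℤ)) :=
    fun p v => crossings p (fun _ => 0) M.init (path v) with hcode
  have hshort : ∀ v, ∃ p ∈ Finset.Ico m (3 * m), 2 * m * (code p v).length ≤ T := by
    intro v
    obtain ⟨p, hp, hle⟩ := Finset.exists_min_image (Finset.Ico m (3 * m))
      (fun p => (code p v).length) ⟨m, by simp; omega⟩
    refine ⟨p, hp, ?_⟩
    have h1 := Finset.card_nsmul_le_sum _ _ _ hle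
    have h2 := sum_length_crossings_le M _ (Finset.Ico m (3 * m)) (fun _ _ => 0) _ _ (hacc v)
    rw [Nat.card_Ico, smul_eq_mul, show 3 * m - m = 2 * m by omega] at h1
    exact h1.trans (h2.trans (hlen v))
  choose cut hcut hcutlen using hshort
  -- Pigeonholes: the cheapest desert boundary and the number of its crossings, which is below `L`
  -- by `hL`.
  set B := Finset.Ico m (3 * m) ×ˢ Finset.range L with hB
  have hBcard : B.card = 2 * m * L := by
    rw [hB, Finset.card_product, Nat.card_Ico, Finset.card_range,
      show 3 * m - m = 2 * m by omega]
  have hmaps : ∀ v ∈ (Finset.univ : Finset (Fin m → Bool)),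
      (cut v, (code (cut v) v).length) ∈ B := by
    intro v _
    refine Finset.mem_product.mpr ⟨hcut v, Finset.mem_range.mpr ?_⟩
    exact lt_of_mul_lt_mul_left' ((hcutlen v).trans_lt hL)
  have hLpos : 0 < L := Nat.pos_of_ne_zero (by rintro rfl; simp at hL)
  obtain ⟨⟨p, ℓ⟩, hb, hfib⟩ := Finset.exists_le_card_fiber_of_nsmul_le_card_of_maps_to
    (b := (2 ^ m : ℝ) / (2 * m * L)) hmaps
    (Finset.card_pos.mp (by rw [hBcard]; positivity))
    (by rw [hBcard, nsmul_eq_mul]; push_cast; rw [mul_div_cancel₀ _ (by positivity)]; simp)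
  set F := Finset.univ.filter fun v => (cut v, (code (cut v) v).length) = (p, ℓ) with hF
  have hmem : ∀ v ∈ F, cut v = p ∧ (code p v).length = ℓ := by
    intro v hv
    obtain ⟨h1, h2⟩ := Prod.mk.inj (Finset.mem_filter.mp hv).2
    exact ⟨h1, h1 ▸ h2⟩
  have hFne : F.Nonempty := by
    rw [← Finset.card_pos, ← Nat.cast_pos (α := ℝ)]
    exact lt_of_lt_of_le (by positivity) hfib
  obtain ⟨v₀, hv₀⟩ := hFne
  have hpm := Finset.mem_Ico.mp (Finset.mem_product.mp hb).1
  have hcount := mul_logb_card_le (N := 2 * m) (ℓ := ℓ) (T := T) (by omega) (by simp)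
    (by rw [← (hmem v₀ hv₀).2, ← (hmem v₀ hv₀).1]; exact hcutlen v₀) F ⟨v₀, hv₀⟩ (code p)
    (fun v _ v' _ hvv => List.ofFn_injective (hM.eq_of_crossings_eq (by simp)
      (by simpa using hpm.1) (by simpa using hpm.2.le) (hacc v) (hacc v') hvv))
    (fun v hv => (hmem v hv).2)
    (fun v _ i => (sum_abs_crossings_le M _ p i _ _ _ (hacc v)).trans
      (by simpa [CounterMachine.init] using hlen v))
  have hlog := Real.logb_le_logb_of_le one_lt_two (by positivity) hfib
  rw [Real.logb_div (by positivity) (by positivity), Real.logb_pow, Real.logb_self_eq_one one_lt_two,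
    Real.logb_mul (by positivity) (by positivity)] at hlog
  have e := mul_le_mul_of_nonneg_left hlog (by positivity : (0 : ℝ) ≤ 2 * m)
  push_cast at hcount
  rw [show (2 : ℝ) * (2 * m) = 4 * m by ring] at hcount
  linarith

/-- The time bound, for every `D` that bounds the number of bits per crossing. -/
theorem CounterMachine.Recognizes.exists_requiresSteps {Q : Type*} [Fintype Q] {k : ℕ} (hk : 1 ≤ k)
    {M : CounterMachine Letter Q k} (hM : M.Recognizes desertPalindromes) {n : ℕ} (hn : 5 ≤ n)
    (hn4 : n % 4 = 1) {D : ℝ}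
    (hD : Real.logb 2 (Fintype.card Q) + k * (Real.logb 2 n + 2) ≤ D) :
    ∃ w ∈ desertPalindromes, w.length = n ∧ M.RequiresSteps w
      (((n : ℝ) ^ 2 - 16 * (n : ℝ) * Real.logb 2 (n : ℝ) - 2 * (n : ℝ)) / (8 * D)) := by
  obtain ⟨m, rfl⟩ : ∃ m, n = 4 * m + 1 := ⟨n / 4, by omega⟩
  have hm : 1 ≤ m := by omega
  set n := 4 * m + 1 with hn_def
  have hnR : (n : ℝ) = 4 * m + 1 := by push_cast [hn_def]; ring
  have hmR : (1 : ℝ) ≤ m := by exact_mod_cast hm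
  have hlogn : 0 ≤ Real.logb 2 n := Real.logb_nonneg one_lt_two (by linarith)
  have hlogs : 0 ≤ Real.logb 2 (Fintype.card Q) :=
    Real.logb_nonneg one_lt_two (by
      exact_mod_cast (by have := hM.two_le_card; omega : 1 ≤ Fintype.card Q))
  have hkR : (1 : ℝ) ≤ k := by exact_mod_cast hk
  have hD1 : 1 ≤ D := by nlinarith
  set b : ℝ := ((n : ℝ) ^ 2 - 16 * n * Real.logb 2 n - 2 * n) / (8 * D) with hb
  by_contra! hcon
  have hfast : ∀ x : List Bool, x.length = m →
      ∃ t : ℕ, (t : ℝ) < b ∧ M.AcceptsIn (desertWord x x) t := by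
    intro x hx
    have := hcon _ (desertWord_self_mem x) (by rw [length_desertWord]; omega)
    rw [RequiresSteps] at this
    push Not at this
    obtain ⟨t, h1, h2⟩ := this ((hM _).1 (desertWord_self_mem x))
    exact ⟨t, h2, h1⟩
  have hb0 : 0 ≤ b := by
    obtain ⟨t, ht, _⟩ := hfast (List.replicate m false) (by simp)
    exact (Nat.cast_nonneg t).trans ht.le
  have hTb : (⌊b⌋₊ : ℝ) ≤ b := Nat.floor_le hb0
  have hbD : b * D = ((n : ℝ) ^ 2 - 16 * n * Real.logb 2 n - 2 * n) / 8 := by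
    rw [hb]; field_simp
  have hTD : (⌊b⌋₊ : ℝ) * D ≤ ((n : ℝ) ^ 2 - 16 * n * Real.logb 2 n - 2 * n) / 8 :=
    hbD ▸ mul_le_mul_of_nonneg_right hTb (by linarith)
  have hnl : 0 ≤ (n : ℝ) * Real.logb 2 n := by positivity
  -- This permits `L = n`, so that the pigeonholes cost at most 2 log n bits.
  have hTn : ⌊b⌋₊ < 2 * m * n := by
    have : (⌊b⌋₊ : ℝ) < 2 * m * n := by
      nlinarith [Nat.cast_nonneg (α := ℝ) ⌊b⌋₊]
    exact_mod_cast this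
  have main := hM.sq_le_mul hm (T := ⌊b⌋₊) (fun x hx => by
    obtain ⟨t, ht, ha⟩ := hfast x hx
    exact ⟨t, Nat.le_floor ht.le, ha⟩) hTn
  have hl2 : Real.logb 2 (2 * m) ≤ Real.logb 2 n :=
    Real.logb_le_logb_of_le one_lt_two (by positivity) (by linarith)
  have hl4 : Real.logb 2 (4 * m) ≤ Real.logb 2 n :=
    Real.logb_le_logb_of_le one_lt_two (by positivity) (by linarith)
  have hcost : Real.logb 2 (Fintype.card Q) + k * (Real.logb 2 (4 * m) + 2) ≤ D :=
    le_trans (by gcongr) hD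
  have e1 := mul_le_mul_of_nonneg_left hcost (Nat.cast_nonneg (α := ℝ) ⌊b⌋₊)
  have e2 := mul_le_mul_of_nonneg_left hl2 (by positivity : (0 : ℝ) ≤ 2 * m)
  have e3 : 4 * (m : ℝ) * Real.logb 2 n ≤ n * Real.logb 2 n := by
    gcongr
    linarith
  have hmn : (m : ℝ) = (n - 1) / 4 := by rw [hnR]; ring
  -- The linear term of `(n - 1) ^ 2` is what the `2 * n` in the bound absorbs.
  have e4 : (2 * m * m : ℝ) = (n - 1) ^ 2 / 8 := by rw [hmn]; ring
  nlinarith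

end DesertPalindromes

theorem mainTheorem3 {Q : Type*} [Fintype Q] :
    (∀ M : CounterMachine Letter Q 1, M.Recognizes desertPalindromes →
      ∃ (d : ℝ) (n₀ : ℕ), ∀ n : ℕ, n₀ ≤ n → n % 4 = 1 →
        ∃ w ∈ desertPalindromes, w.length = n ∧
          M.RequiresSteps w
            (((n : ℝ) ^ 2 - 16 * (n : ℝ) * Real.logb 2 (n : ℝ) - d * (n : ℝ)) /
              (8 * (Real.logb 2 (n : ℝ) + 2 * Real.logb 2 (Fintype.card Q : ℝ) + 1)))) ∧
    (∀ k : ℕ, 1 ≤ k → ∀ M : CounterMachine Letter Q k, M.Recognizes desertPalindromes →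
      ∃ (d : ℝ) (n₀ : ℕ), ∀ n : ℕ, n₀ ≤ n → n % 4 = 1 →
        ∃ w ∈ desertPalindromes, w.length = n ∧
          M.RequiresSteps w
            (((n : ℝ) ^ 2 - 16 * (n : ℝ) * Real.logb 2 (n : ℝ) - d * (n : ℝ)) /
              (8 * (2 * (k : ℝ) * Real.logb 2 (n : ℝ) +
                Real.logb 2 (Fintype.card Q : ℝ))))) := by
  refine ⟨fun M hM => ⟨2, 5, fun n hn hn4 => hM.exists_requiresSteps le_rfl hn hn4 ?_⟩,
    fun k hk M hM => ⟨2, 5, fun n hn hn4 => hM.exists_requiresSteps hk hn hn4 ?_⟩⟩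
  -- A second log s replaces one of the two extra bits.
  · have hs : 1 ≤ Real.logb 2 (Fintype.card Q : ℝ) := by
      rw [Real.le_logb_iff_rpow_le one_lt_two (by exact_mod_cast (by
        have := hM.two_le_card; omega : 0 < Fintype.card Q)), Real.rpow_one]
      exact_mod_cast hM.two_le_card
    push_cast
    linarith
  -- A second log n per counter replaces its two extra bits.
  · have hl : 2 ≤ Real.logb 2 (n : ℝ) := by
      rw [Real.le_logb_iff_rpow_le one_lt_two (by exact_mod_cast (by omega : 0 < n))]
      norm_num
      exact_mod_cast (by omega : 4 ≤ n)
    have := mul_le_mul_of_nonneg_left hl (Nat.cast_nonneg (α := ℝ) k)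
    linarith
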